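/- For a positive integer $n$ and $f\colon\{0,1\}^n\to\{0,1\}$, a rational representation of $f$ is a pair $(p,q)$ of multilinear polynomials $p,q\in\mathbb{R}[X_1,\dots,X_n]$ (that is, of degree at most one in each variable) such that $q(x)\neq 0$ and $p(x)/q(x)=f(x)$ for all $x\in\{0,1\}^n$. The rational degree $\operatorname{rdeg}(f)$ is the minimum of $\max(\deg p,\deg q)$ over all rational representations of $f$. We say that $f$ depends on all $n$ variables if for every $i\in\{1,\dots,n\}$ there is an $x\in\{0,1\}^n$ such that flipping the $i$-th bit of $x$ changes the value of $f$. Theorem. There is an absolute constant $c>0$ such that, for every positive integer $n$ and every $f\colon\{0,1\}^n\to\{0,1\}$ that depends on all $n$ variables, $\operatorname{rdeg}(f)\geq c\log n$. In short, $\operatorname{rdeg}(f)\geq\Omega(\log n)$. -/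

import Mathlib

/-- The real `0/1`-vector of a Boolean input `x ∈ {0,1}^n`. -/
def bitVec {n : ℕ} (x : Fin n → Bool) : Fin n → ℝ :=
  fun i => if x i then 1 else 0

/-- A polynomial is multilinear if every variable has degree at most one in it. -/
def IsMultilinear {n : ℕ} (p : MvPolynomial (Fin n) ℝ) : Prop :=
  ∀ i : Fin n, p.degreeOf i ≤ 1

/-- `p / q` is a rational representation of `f : {0,1}^n → {0,1}`: the polynomials `p` and `q` are
multilinear, `q` vanishes nowhere on `{0,1}^n`, and `p(x) / q(x) = f(x)` on `{0,1}^n`. -/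
def IsRationalRep {n : ℕ} (f : (Fin n → Bool) → Bool) (p q : MvPolynomial (Fin n) ℝ) : Prop :=
  IsMultilinear p ∧ IsMultilinear q ∧
    ∀ x : Fin n → Bool, MvPolynomial.eval (bitVec x) q ≠ 0 ∧
      MvPolynomial.eval (bitVec x) p / MvPolynomial.eval (bitVec x) q = if f x then 1 else 0

/-- The numbers `max (deg p) (deg q)` over all rational representations `p / q` of `f`. -/
def rationalRepDegrees {n : ℕ} (f : (Fin n → Bool) → Bool) : Set ℕ :=
  {d | ∃ p q : MvPolynomial (Fin n) ℝ,
    IsRationalRep f p q ∧ max p.totalDegree q.totalDegree = d}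

/-- The rational degree of `f`: the minimum of `max (deg p) (deg q)` over all rational
representations `p / q` of `f` (one exists, see `rationalRepDegrees_nonempty`). -/
noncomputable def rdeg {n : ℕ} (f : (Fin n → Bool) → Bool) : ℕ :=
  sInf (rationalRepDegrees f)

/-- `f` depends on all its variables: for every coordinate `i` there is an input at which flipping
the bit `i` changes the value of `f`. -/
def DependsOnAllVariables {n : ℕ} (f : (Fin n → Bool) → Bool) : Prop :=
  ∀ i : Fin n, ∃ x : Fin n → Bool, f (Function.update x i (!x i)) ≠ f x

/-- Every Boolean function has a rational representation (with denominator `1`), so the infimum in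
`rdeg` is an attained minimum. -/
theorem rationalRepDegrees_nonempty {n : ℕ} (f : (Fin n → Bool) → Bool) :
    (rationalRepDegrees f).Nonempty := by
  classical
  let L : Bool → Fin n → MvPolynomial (Fin n) ℝ := fun b i =>
    if b then MvPolynomial.X i else 1 - MvPolynomial.X i
  have hL : ∀ b i j, (L b i).degreeOf j ≤ if i = j then 1 else 0 := by
    intro b i j
    have hX : (MvPolynomial.X i : MvPolynomial (Fin n) ℝ).degreeOf j ≤ if i = j then 1 else 0 := by
      rw [MvPolynomial.degreeOf_X]; simp only [eq_comm (a := i)]; exact le_rfl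
    cases b
    · refine (MvPolynomial.degreeOf_sub_le _ _ _).trans (max_le ?_ hX)
      have h1 : (1 : MvPolynomial (Fin n) ℝ).degreeOf j = 0 := MvPolynomial.degreeOf_one j
      simp [h1]
    · exact hX
  have hev : ∀ (y x : Fin n → Bool), MvPolynomial.eval (bitVec x) (∏ i, L (y i) i)
      = if x = y then 1 else 0 := by
    intro y x
    rw [map_prod]
    split_ifs with h
    · subst h
      refine Finset.prod_eq_one fun i _ => ?_
      cases hx : x i <;> simp [L, bitVec, hx]
    · obtain ⟨i, hi⟩ := Function.ne_iff.mp h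
      refine Finset.prod_eq_zero (Finset.mem_univ i) ?_
      cases hx : x i <;> cases hy : y i <;> simp_all [L, bitVec]
  let p : MvPolynomial (Fin n) ℝ :=
    ∑ y : Fin n → Bool, MvPolynomial.C (if f y then 1 else 0) * ∏ i, L (y i) i
  refine ⟨_, p, 1, ⟨?_, ?_, ?_⟩, rfl⟩
  · intro j
    refine (MvPolynomial.degreeOf_sum_le _ _ _).trans (Finset.sup_le fun y _ => ?_)
    refine (MvPolynomial.degreeOf_C_mul_le _ _ _).trans
      ((MvPolynomial.degreeOf_prod_le _ _ _).trans ?_)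
    exact (Finset.sum_le_sum fun i _ => hL (y i) i j).trans (by simp)
  · intro j
    simp [MvPolynomial.degreeOf_one]
  · intro x
    have hp : MvPolynomial.eval (bitVec x) p = if f x then 1 else 0 := by
      simp only [p, map_sum, map_mul, MvPolynomial.eval_C, hev]
      simp
    simp [hp]

/-! If `p / q` represents `f` in degree `d`, put `r = q - p`. On the cube, `p` is nonzero exactly
where `f` is true and `r` exactly where `f` is false. The rest uses only this pair, and compares two
bounds on influences.

From below: for each variable `i`, with `x^i` denoting the flip, `p(x) r(x^i)` is a nonzero function
of degree at most `2d`. It is thus nonzero on a `2^(-2d)` fraction of the cube, where `f` is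
sensitive to `i` (`two_pow_card_le_sensitivityCount`).

From above: the total influence is at most `2d^4` (`sum_sensitivityCount_le`). At a maximum of
`|p|`, Markov's inequality yields at most `2d^3` coordinates whose fixing kills `r`
(`exists_certificate`). Fixing the same coordinates to any other values then lowers the degree bound
of `r`, and one inducts on it.

Hence `n ≤ 2^(2d) * 2d^4`, so `d` is at least of order `log n`. -/

namespace BooleanCube

open Finset

variable {ι κ : Type*}

/-! ### Functions of bounded degree on the cube. -/

/-- The monomial `∏_{i ∈ S} x_i` as a real function on the Boolean cube. -/
def monomialFun (S : Finset ι) (x : ι → Bool) : ℝ :=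
  ∏ i ∈ S, if x i then 1 else 0

/-- The real functions on the Boolean cube that are given by a polynomial of degree at most `d`. -/
def degLE (ι : Type*) (d : ℕ) : Submodule ℝ ((ι → Bool) → ℝ) :=
  Submodule.span ℝ {F | ∃ S : Finset ι, S.card ≤ d ∧ F = monomialFun S}

/-- The indicator vector of a finite set of coordinates. -/
def indicatorVec [DecidableEq ι] (S : Finset ι) : ι → Bool := fun i => decide (i ∈ S)

/-- The number of inputs at which flipping the bit `i` changes the value of `f`. -/
def sensitivityCount [Fintype ι] [DecidableEq ι] (f : (ι → Bool) → Bool) (i : ι) : ℕ :=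
  #{x | f (Function.update x i (!x i)) ≠ f x}

lemma monomialFun_mem_degLE {d : ℕ} {S : Finset ι} (hS : S.card ≤ d) :
    monomialFun S ∈ degLE ι d :=
  Submodule.subset_span ⟨S, hS, rfl⟩

lemma degLE_mono {d e : ℕ} (h : d ≤ e) : degLE ι d ≤ degLE ι e :=
  Submodule.span_mono fun _ ⟨S, hS, hF⟩ => ⟨S, hS.trans h, hF⟩

lemma monomialFun_mul [DecidableEq ι] (S T : Finset ι) :
    monomialFun S * monomialFun T = monomialFun (S ∪ T) := by
  funext x
  simp only [Pi.mul_apply, monomialFun, Finset.prod_boole]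
  by_cases h1 : ∀ i ∈ S, x i = true <;> by_cases h2 : ∀ i ∈ T, x i = true <;> grind

lemma const_mem_degLE (c : ℝ) (d : ℕ) : (fun _ => c) ∈ degLE ι d := by
  have h := (degLE ι d).smul_mem c (monomialFun_mem_degLE (S := ∅) (by simp))
  convert h using 1
  funext x
  simp [monomialFun]

lemma coord_mem_degLE (i : ι) : (fun x : ι → Bool => if x i then (1 : ℝ) else 0) ∈ degLE ι 1 := by
  convert monomialFun_mem_degLE (S := {i}) (d := 1) (by simp) using 1
  funext x
  simp [monomialFun]

lemma coord_not_mem_degLE (i : ι) :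
    (fun x : ι → Bool => if !x i then (1 : ℝ) else 0) ∈ degLE ι 1 := by
  convert (degLE ι 1).sub_mem (const_mem_degLE 1 1) (coord_mem_degLE i) using 1
  funext x
  cases h : x i <;> simp [h]

lemma mul_mem_degLE {d e : ℕ} {F G : (ι → Bool) → ℝ} (hF : F ∈ degLE ι d) (hG : G ∈ degLE ι e) :
    F * G ∈ degLE ι (d + e) := by
  classical
  induction hF, hG using Submodule.span_induction₂ with
  | mem_mem F G hF hG =>
    obtain ⟨S, hS, rfl⟩ := hF
    obtain ⟨T, hT, rfl⟩ := hG
    rw [monomialFun_mul]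
    exact monomialFun_mem_degLE ((card_union_le _ _).trans (add_le_add hS hT))
  | zero_left => rw [zero_mul]; exact Submodule.zero_mem _
  | zero_right => rw [mul_zero]; exact Submodule.zero_mem _
  | add_left x y z _ _ _ h1 h2 => rw [add_mul]; exact Submodule.add_mem _ h1 h2
  | add_right x y z _ _ _ h1 h2 => rw [mul_add]; exact Submodule.add_mem _ h1 h2
  | smul_left c x y _ _ h => rw [smul_mul_assoc]; exact Submodule.smul_mem _ _ h
  | smul_right c x y _ _ h => rw [mul_smul_comm]; exact Submodule.smul_mem _ _ h

lemma monomialFun_comp_mem_degLE {σ : (κ → Bool) → ι → Bool}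
    (hσ : ∀ i, (fun y => if σ y i then (1 : ℝ) else 0) ∈ degLE κ 1) (S : Finset ι) :
    (fun y => monomialFun S (σ y)) ∈ degLE κ S.card := by
  classical
  induction S using Finset.induction_on with
  | empty => simpa [monomialFun] using const_mem_degLE (ι := κ) 1 0
  | insert i S hi ih =>
    rw [card_insert_of_notMem hi, add_comm]
    convert mul_mem_degLE (hσ i) ih using 1
    funext y
    simp only [monomialFun, Pi.mul_apply, prod_insert hi]

/-- Substituting affine functions into the coordinates does not raise the degree. -/
lemma comp_mem_degLE {σ : (κ → Bool) → ι → Bool}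
    (hσ : ∀ i, (fun y => if σ y i then (1 : ℝ) else 0) ∈ degLE κ 1) {d : ℕ}
    {F : (ι → Bool) → ℝ} (hF : F ∈ degLE ι d) : (fun y => F (σ y)) ∈ degLE κ d := by
  induction hF using Submodule.span_induction with
  | mem F hF =>
    obtain ⟨S, hS, rfl⟩ := hF
    exact degLE_mono hS (monomialFun_comp_mem_degLE hσ S)
  | zero => exact Submodule.zero_mem _
  | add F G _ _ h1 h2 => exact Submodule.add_mem _ h1 h2
  | smul c F _ h => exact Submodule.smul_mem _ c h

lemma comp_piecewise_mem_degLE [DecidableEq ι] (K : Finset ι) (a : ι → Bool) {d : ℕ}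
    {F : (ι → Bool) → ℝ} (hF : F ∈ degLE ι d) : (fun x => F (K.piecewise a x)) ∈ degLE ι d := by
  refine comp_mem_degLE (fun i => ?_) hF
  by_cases hi : i ∈ K
  · simpa [hi] using const_mem_degLE (ι := ι) (if a i then 1 else 0) 1
  · simpa [hi] using coord_mem_degLE i

lemma comp_xor_mem_degLE (a : ι → Bool) {d : ℕ}
    {F : (ι → Bool) → ℝ} (hF : F ∈ degLE ι d) : (fun x => F (fun i => a i ^^ x i)) ∈ degLE ι d := by
  refine comp_mem_degLE (fun i => ?_) hF
  cases a i
  · simpa using coord_mem_degLE i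
  · simpa using coord_not_mem_degLE i

lemma comp_flip_mem_degLE [DecidableEq ι] (i : ι) {d : ℕ}
    {F : (ι → Bool) → ℝ} (hF : F ∈ degLE ι d) :
    (fun x => F (Function.update x i (!x i))) ∈ degLE ι d := by
  refine comp_mem_degLE (fun j => ?_) hF
  by_cases hj : j = i
  · subst hj
    simpa using coord_not_mem_degLE j
  · simpa [hj] using coord_mem_degLE j

lemma apply_eq_of_mem_degLE_zero {F : (ι → Bool) → ℝ} (hF : F ∈ degLE ι 0) (x y : ι → Bool) :
    F x = F y := by
  induction hF using Submodule.span_induction with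
  | mem F hF =>
    obtain ⟨S, hS, rfl⟩ := hF
    obtain rfl : S = ∅ := by simpa using hS
    simp [monomialFun]
  | zero => rfl
  | add F G _ _ h1 h2 => simp [h1, h2]
  | smul c F _ h => simp [h]

/-- Two restrictions to parallel subcubes differ by a function of smaller degree. -/
lemma piecewise_sub_piecewise_mem_degLE [DecidableEq ι] (K : Finset ι) (a b : ι → Bool) {d : ℕ}
    {F : (ι → Bool) → ℝ} (hF : F ∈ degLE ι (d + 1)) :
    (fun x => F (K.piecewise a x) - F (K.piecewise b x)) ∈ degLE ι d := by
  induction hF using Submodule.span_induction with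
  | mem F hF =>
    obtain ⟨S, hS, rfl⟩ := hF
    have key : ∀ c : ι → Bool, (fun x => monomialFun S (K.piecewise c x)) =
        fun x => monomialFun (S ∩ K) c * monomialFun (S \ K) x := by
      intro c
      funext x
      simp only [monomialFun]
      rw [← prod_inter_mul_prod_sdiff S K]
      congr 1
      · exact prod_congr rfl fun i hi => by simp [(mem_inter.1 hi).2]
      · exact prod_congr rfl fun i hi => by simp [(mem_sdiff.1 hi).2]
    have key' : (fun x => monomialFun S (K.piecewise a x) - monomialFun S (K.piecewise b x)) =
        (monomialFun (S ∩ K) a - monomialFun (S ∩ K) b) • monomialFun (S \ K) := by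
      funext x
      have ha := congrFun (key a) x
      have hb := congrFun (key b) x
      beta_reduce at ha hb
      simp only [ha, hb, Pi.smul_apply, smul_eq_mul]
      ring
    rw [key']
    rcases (S ∩ K).eq_empty_or_nonempty with h | h
    · simp [h, monomialFun]
    · refine Submodule.smul_mem _ _ (monomialFun_mem_degLE ?_)
      have := card_inter_add_card_sdiff S K
      have := h.card_pos
      omega
  | zero => simp only [Pi.zero_apply, sub_zero]; exact Submodule.zero_mem _
  | add F G _ _ h1 h2 =>
    convert Submodule.add_mem _ h1 h2 using 1
    funext x
    simp only [Pi.add_apply]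
    ring
  | smul c F _ h =>
    convert Submodule.smul_mem _ c h using 1
    funext x
    simp only [Pi.smul_apply, smul_eq_mul]
    ring

lemma update_sub_update_mem_degLE [DecidableEq ι] (i : ι) {d : ℕ}
    {F : (ι → Bool) → ℝ} (hF : F ∈ degLE ι (d + 1)) :
    (fun x => F (Function.update x i true) - F (Function.update x i false)) ∈ degLE ι d := by
  simpa [piecewise_singleton] using
    piecewise_sub_piecewise_mem_degLE {i} (fun _ => true) (fun _ => false) hF

/-! ### Zeros of low-degree functions. -/

/-- A nonzero polynomial of degree at most `d` is nonzero at a `2 ^ (-d)` fraction of the cube. -/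
theorem two_pow_card_le_card_ne_zero [Fintype ι] [DecidableEq ι] {d : ℕ} {F : (ι → Bool) → ℝ}
    (hF : F ∈ degLE ι d) (h0 : F ≠ 0) : 2 ^ Fintype.card ι ≤ 2 ^ d * #{x | F x ≠ 0} := by
  have hconst : ∀ F : (ι → Bool) → ℝ, F ≠ 0 → (∀ x y, F x = F y) →
      #{x | F x ≠ 0} = 2 ^ Fintype.card ι := by
    intro F h0 h
    obtain ⟨x₀, hx₀⟩ := Function.ne_iff.1 h0
    rw [filter_true_of_mem fun x _ => by rw [h x x₀]; exact hx₀]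
    simp
  induction d generalizing F with
  | zero => simp [hconst F h0 (apply_eq_of_mem_degLE_zero hF)]
  | succ d ih =>
    by_cases hD : ∀ i x, F (Function.update x i true) = F (Function.update x i false)
    · have hc : ∀ x y, F x = F y := by
        intro x y
        have : ∀ S : Finset ι, F (S.piecewise x y) = F y := by
          intro S
          induction S using Finset.induction_on with
          | empty => simp
          | insert i S hi ih =>
            have hb : ∀ z b, F (Function.update z i b) = F z := by
              intro z b
              have hz : F (Function.update z i (z i)) = F z := by simp
              have := hD i z
              cases b <;> cases hzi : z i <;> simp_all
            rw [piecewise_insert, hb, ih]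
        simpa using this univ
      rw [hconst F h0 hc]
      exact Nat.le_mul_of_pos_left _ (by positivity)
    · push Not at hD
      obtain ⟨i, x₀, hx₀⟩ := hD
      have hG := update_sub_update_mem_degLE i hF
      refine (ih hG (Function.ne_iff.2 ⟨x₀, sub_ne_zero.2 hx₀⟩)).trans ?_
      have hinv : Function.Involutive fun x : ι → Bool => Function.update x i (!x i) := by
        intro x; simp
      have hflip : #{x | F (Function.update x i (!x i)) ≠ 0} = #{x | F x ≠ 0} := by
        refine card_bij (fun x _ => Function.update x i (!x i)) ?_ ?_ ?_
        · simp
        · intro x _ y _ h; exact hinv.injective h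
        · intro y hy
          refine ⟨Function.update y i (!y i), ?_, hinv y⟩
          simpa using hy
      -- Where the difference in direction `i` is nonzero, `F` is nonzero at `x` or at its flip;
      -- this costs the factor 2 per degree.
      have hsub : ({x | F (Function.update x i true) - F (Function.update x i false) ≠ 0} :
          Finset (ι → Bool)) ⊆
          ({x | F x ≠ 0} : Finset _) ∪ ({x | F (Function.update x i (!x i)) ≠ 0} : Finset _) := by
        intro x hx
        simp only [mem_filter, mem_univ, true_and, mem_union] at hx ⊢
        by_contra! hcon
        have hz : F (Function.update x i (x i)) = 0 := by simpa using hcon.1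
        have hz' := hcon.2
        apply hx
        cases hxi : x i <;> simp_all
      have := (card_le_card hsub).trans (card_union_le _ _)
      rw [hflip] at this
      calc _ ≤ 2 ^ d * (#{x | F x ≠ 0} + #{x | F x ≠ 0}) := Nat.mul_le_mul_left _ this
        _ = _ := by ring

/-- A polynomial of degree at most `d` that vanishes on all subsets of `B` with at most `d` elements
vanishes at `B`. -/
theorem apply_indicatorVec_eq_zero [DecidableEq ι] {d : ℕ} {F : (ι → Bool) → ℝ}
    (hF : F ∈ degLE ι d) (B : Finset ι) (h : ∀ S ⊆ B, #S ≤ d → F (indicatorVec S) = 0) :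
    F (indicatorVec B) = 0 := by
  induction d generalizing F B with
  | zero =>
    rw [apply_eq_of_mem_degLE_zero hF _ (indicatorVec ∅)]
    exact h ∅ (by simp) (by simp)
  | succ d ih =>
    induction B using Finset.induction_on with
    | empty => exact h ∅ (by simp) (by simp)
    | insert i B hi ihB =>
      have hup : ∀ S : Finset ι, i ∉ S →
          Function.update (indicatorVec S) i true = indicatorVec (insert i S) ∧
          Function.update (indicatorVec S) i false = indicatorVec S := by
        intro S hS
        constructor <;> funext j <;> by_cases hj : j = i <;> simp_all [indicatorVec]
      have hB := ihB fun S hS => h S (hS.trans (subset_insert i B))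
      -- The difference in direction `i` inherits the hypothesis on `B` in degree `d`, since adding
      -- `i` to a set costs one element.
      have hD := ih (update_sub_update_mem_degLE i hF) B fun S hS hcard => by
        have hiS : i ∉ S := fun hc => hi (hS hc)
        simp only [(hup S hiS).1, (hup S hiS).2]
        rw [h _ (insert_subset_insert i hS) ((card_insert_le _ _).trans (by omega)),
          h S (hS.trans (subset_insert i B)) (by omega), sub_zero]
      simp only [(hup B hi).1, (hup B hi).2, hB, sub_zero] at hD
      exact hD

/-! ### Bernoulli means and Markov's inequality. -/

open Polynomial in
/-- The expectation of `F` at a random point whose bits are independently `1` with probability `X`,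
as a polynomial in `X`. -/
noncomputable def bernoulliMean [Fintype κ] [DecidableEq κ] : ((κ → Bool) → ℝ) →ₗ[ℝ] ℝ[X] :=
  ∑ y : κ → Bool, (LinearMap.proj y).smulRight (∏ j, if y j then (X : ℝ[X]) else 1 - X)

section
open Polynomial

variable [Fintype κ] [DecidableEq κ]

lemma bernoulliMean_apply (F : (κ → Bool) → ℝ) :
    bernoulliMean F = ∑ y : κ → Bool, F y • ∏ j, if y j then (X : ℝ[X]) else 1 - X := by
  simp [bernoulliMean, LinearMap.sum_apply]

/-- The expectation of a product of independent bits factors. -/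
lemma bernoulliMean_monomialFun (J : Finset κ) :
    bernoulliMean (monomialFun J) = (X : ℝ[X]) ^ #J := by
  have h := prod_univ_sum (fun _ : κ => (univ : Finset Bool))
    (fun j b => (if j ∈ J then (if b then (1 : ℝ[X]) else 0) else 1) *
      if b then (X : ℝ[X]) else 1 - X)
  rw [Fintype.piFinset_univ] at h
  rw [bernoulliMean_apply]
  trans ∏ j : κ, if j ∈ J then (X : ℝ[X]) else 1
  · rw [show (∏ j : κ, if j ∈ J then (X : ℝ[X]) else 1) = _ from
      (prod_congr rfl fun j _ => by by_cases hj : j ∈ J <;> simp [hj]).trans h]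
    refine sum_congr rfl fun y _ => ?_
    rw [prod_mul_distrib, smul_eq_C_mul]
    congr 1
    rw [monomialFun, map_prod, prod_ite_mem, univ_inter]
    exact prod_congr rfl fun j _ => by cases y j <;> simp
  · rw [prod_ite_mem, univ_inter, prod_const]

lemma degree_bernoulliMean_le {d : ℕ} {F : (κ → Bool) → ℝ} (hF : F ∈ degLE κ d) :
    (bernoulliMean F).natDegree ≤ d := by
  induction hF using Submodule.span_induction with
  | mem F hF =>
    obtain ⟨S, hS, rfl⟩ := hF
    simpa [bernoulliMean_monomialFun] using hS
  | zero => simp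
  | add F G _ _ h1 h2 =>
    rw [map_add]
    exact (natDegree_add_le _ _).trans (max_le h1 h2)
  | smul c F _ h =>
    rw [map_smul]
    exact (natDegree_smul_le _ _).trans h

/-- By linearity it suffices to treat monomials, where both sides see only those of degree one. -/
lemma eval_derivative_bernoulliMean {d : ℕ} {F : (κ → Bool) → ℝ} (hF : F ∈ degLE κ d) :
    (derivative (bernoulliMean F)).eval 0 =
      ∑ j, (F (indicatorVec {j}) - F (indicatorVec ∅)) := by
  induction hF using Submodule.span_induction with
  | mem F hF =>
    obtain ⟨S, hS, rfl⟩ := hF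
    rw [bernoulliMean_monomialFun]
    rcases S.eq_empty_or_nonempty with rfl | ⟨i, hi⟩
    · simp [monomialFun]
    · have h0 : monomialFun S (indicatorVec ∅) = 0 := by
        unfold monomialFun
        exact prod_eq_zero hi (by simp [indicatorVec])
      simp only [h0, sub_zero]
      by_cases hS1 : S = {i}
      · subst hS1
        simp [monomialFun, indicatorVec]
      · have h1 : 1 < #S := by
          rw [one_lt_card]
          by_contra! hc
          exact hS1 (eq_singleton_iff_unique_mem.2 ⟨hi, fun y hy => hc y hy i hi⟩)
        have hz : ∀ j, monomialFun S (indicatorVec {j}) = 0 := by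
          intro j
          obtain ⟨k, hk, hkj⟩ := exists_mem_ne h1 j
          exact prod_eq_zero hk (by simp [indicatorVec, hkj])
        have h2 : #S - 1 ≠ 0 := Nat.sub_ne_zero_of_lt h1
        simp [hz, derivative_X_pow, h2]
  | zero => simp
  | add F G _ _ h1 h2 =>
    simp only [map_add, eval_add, h1, h2, Pi.add_apply, ← sum_add_distrib]
    exact sum_congr rfl fun _ _ => by ring
  | smul c F _ h =>
    simp only [map_smul, eval_smul, h, Pi.smul_apply, smul_eq_mul, mul_sum]
    exact sum_congr rfl fun _ _ => by ring

lemma abs_eval_bernoulliMean_le {F : (κ → Bool) → ℝ} (hF : ∀ x, |F x| ≤ 1) {t : ℝ}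
    (h0 : 0 ≤ t) (h1 : t ≤ 1) : |(bernoulliMean F).eval t| ≤ 1 := by
  have hone : ∑ y : κ → Bool, ∏ j, (if y j then t else 1 - t) = 1 := by
    have := congrArg (eval t) (bernoulliMean_monomialFun (∅ : Finset κ))
    rw [bernoulliMean_apply] at this
    simpa [eval_finsetSum, eval_prod, monomialFun, apply_ite (eval t)] using this
  rw [bernoulliMean_apply, eval_finsetSum, ← hone]
  refine (abs_sum_le_sum_abs _ _).trans (sum_le_sum fun y _ => ?_)
  have hnn : 0 ≤ ∏ j, (if y j then t else 1 - t) :=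
    prod_nonneg fun j _ => by split_ifs <;> linarith
  simp only [eval_smul, eval_prod, apply_ite (eval t), eval_X, eval_sub, eval_one, smul_eq_mul,
    abs_mul, abs_of_nonneg hnn]
  exact mul_le_of_le_one_left hnn (hF y)

/-- Markov brothers' inequality on the cube: the total drop in the coordinate directions of
a bounded polynomial of degree at most `d`. -/
theorem sum_sub_le_two_mul_sq {d : ℕ} {F : (κ → Bool) → ℝ} (hF : F ∈ degLE κ d)
    (hb : ∀ x, |F x| ≤ 1) :
    ∑ j, (F (indicatorVec ∅) - F (indicatorVec {j})) ≤ 2 * (d : ℝ) ^ 2 := by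
  -- The substitution `t = (1 - x) / 2` maps `[-1, 1]` to `[0, 1]` and `1` to `0`. The derivative at
  -- `1` is at most `T_d'(1) = d^2`, and the inner slope `-1/2` gives the sign and the factor 2.
  set Q : ℝ[X] := (bernoulliMean F).comp (C (1 / 2) - C (1 / 2) * X) with hQ
  have hdeg : Q.degree ≤ d := by
    refine degree_le_of_natDegree_le (natDegree_comp_le.trans ?_)
    have h1 : (C (1 / 2 : ℝ) - C (1 / 2) * X).natDegree ≤ 1 := by compute_degree
    exact (Nat.mul_le_mul (degree_bernoulliMean_le hF) h1).trans (by simp)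
  have hbd : ∀ x ∈ Set.Icc (-1 : ℝ) 1, |Q.eval x| ≤ 1 := by
    intro x hx
    rw [hQ, eval_comp]
    apply abs_eval_bernoulliMean_le hb <;> simp <;> linarith [hx.1, hx.2]
  have := Polynomial.Chebyshev.eval_iterate_derivative_le_of_forall_abs_le_one (k := 1)
    le_rfl hdeg hbd
  simp only [Function.iterate_one, Polynomial.Chebyshev.derivative_T_eval_one] at this
  rw [hQ, derivative_comp] at this
  simp only [eval_mul, eval_comp, eval_sub, eval_C, eval_X, mul_one, sub_self,
    eval_derivative_bernoulliMean hF, derivative_sub, derivative_C, derivative_C_mul, derivative_X,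
    zero_sub, eval_neg, Int.cast_natCast, sum_sub_distrib] at this
  rw [sum_sub_distrib]
  linarith

end

/-! ### Certificates from disjoint blocks. -/

/-- If `p` attains its maximal absolute value at the origin and vanishes on every member of
a disjoint family, then the family has at most `2 d ^ 2` members. -/
theorem card_le_of_pairwiseDisjoint [DecidableEq ι] {d : ℕ}
    {p : (ι → Bool) → ℝ} (hp : p ∈ degLE ι d) (hmax : ∀ x, |p x| ≤ |p (indicatorVec ∅)|)
    (h0 : p (indicatorVec ∅) ≠ 0) (A : Finset (Finset ι))
    (hA : (A : Set (Finset ι)).PairwiseDisjoint id)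
    (hz : ∀ S ∈ A, p (indicatorVec S) = 0) : #A ≤ 2 * d ^ 2 := by
  -- One switch per block: by disjointness each coordinate depends on at most one switch, so
  -- substituting does not raise the degree.
  let σ : (A → Bool) → ι → Bool := fun y i => decide (∃ S : A, y S = true ∧ i ∈ S.1)
  have hσ : ∀ i, (fun y => if σ y i then (1 : ℝ) else 0) ∈ degLE A 1 := by
    intro i
    by_cases hi : ∃ S : A, i ∈ S.1
    · obtain ⟨S, hS⟩ := hi
      convert coord_mem_degLE S using 3 with y
      simp only [σ, decide_eq_true_eq]
      refine ⟨?_, fun h => ⟨S, h, hS⟩⟩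
      rintro ⟨T, hT, hiT⟩
      have : S = T := by
        by_contra hne
        exact disjoint_left.1 (hA S.2 T.2 (fun h => hne (Subtype.ext h))) hS hiT
      rwa [this]
    · convert const_mem_degLE 0 1 using 2 with y
      simp only [σ, decide_eq_true_eq, ite_eq_right_iff]
      rintro ⟨T, -, hiT⟩
      exact absurd ⟨T, hiT⟩ hi
  have hσ0 : σ (indicatorVec ∅) = indicatorVec ∅ := by
    funext i; simp [σ, indicatorVec]
  have hσ1 : ∀ S : A, σ (indicatorVec {S}) = indicatorVec S.1 := by
    intro S; funext i; simp [σ, indicatorVec]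
  -- After normalization every switch produces a drop of exactly 1, so the sum of drops is `#A`.
  have hF := Submodule.smul_mem _ (p (indicatorVec ∅))⁻¹ (comp_mem_degLE hσ hp)
  have := sum_sub_le_two_mul_sq hF fun y => by
    simp only [Pi.smul_apply, smul_eq_mul, abs_mul, abs_inv]
    rw [inv_mul_le_iff₀ (abs_pos.2 h0), mul_one]
    exact hmax _
  simp only [Pi.smul_apply, smul_eq_mul, hσ0, hσ1, inv_mul_cancel₀ h0, hz _ (Subtype.prop _),
    mul_zero, sub_zero, sum_const, card_univ, Fintype.card_coe, nsmul_eq_mul, mul_one] at this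
  exact_mod_cast this

/-- A small certificate at a point where `|p|` is maximal. -/
theorem exists_certificate [Fintype ι] [DecidableEq ι] {d : ℕ} {p r : (ι → Bool) → ℝ}
    (hp : p ∈ degLE ι d) (hr : r ∈ degLE ι d) (hpr : ∀ x, p x = 0 ↔ r x ≠ 0) (hne : p ≠ 0) :
    ∃ (a : ι → Bool) (K : Finset ι), #K ≤ 2 * d ^ 3 ∧ ∀ x, r (K.piecewise a x) = 0 := by
  classical
  obtain ⟨a, -, ha⟩ := exists_max_image (univ : Finset (ι → Bool)) (fun x => |p x|)
    ⟨_, mem_univ default⟩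
  obtain ⟨z, hz⟩ := Function.ne_iff.1 hne
  have hpa : p a ≠ 0 := abs_pos.1 ((abs_pos.2 hz).trans_le (ha z (mem_univ z)))
  have hra : r a = 0 := by
    by_contra h
    exact hpa ((hpr a).2 h)
  let P : (ι → Bool) → ℝ := fun x => p fun i => a i ^^ x i
  let R : (ι → Bool) → ℝ := fun x => r fun i => a i ^^ x i
  have hP : P ∈ degLE ι d := comp_xor_mem_degLE a hp
  have hR : R ∈ degLE ι d := comp_xor_mem_degLE a hr
  have hP0 : P (indicatorVec ∅) = p a := by simp [P, indicatorVec]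
  have hR0 : R (indicatorVec ∅) = 0 := by simp [R, indicatorVec, hra]
  -- A largest disjoint family of small blocks whose flipping from `a` makes `r` nonzero; its union
  -- is the certificate.
  let 𝒜 : Finset (Finset (Finset ι)) := {A | (A : Set (Finset ι)).PairwiseDisjoint id ∧
    ∀ S ∈ A, #S ≤ d ∧ R (indicatorVec S) ≠ 0}
  obtain ⟨A, hA, hAmax⟩ := exists_max_image 𝒜 card ⟨∅, by simp [𝒜]⟩
  simp only [𝒜, mem_filter, mem_univ, true_and] at hA hAmax
  have hcard : #A ≤ 2 * d ^ 2 := by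
    refine card_le_of_pairwiseDisjoint hP (fun x => ?_) (by rwa [hP0]) A hA.1 fun S hS => ?_
    · rw [hP0]
      exact ha _ (mem_univ _)
    · exact (hpr _).2 (hA.2 S hS).2
  refine ⟨a, A.biUnion id, ?_, fun x => ?_⟩
  · refine (card_biUnion_le_card_mul A id d fun S hS => (hA.2 S hS).1).trans ?_
    calc _ ≤ 2 * d ^ 2 * d := Nat.mul_le_mul_right d hcard
      _ = _ := by ring
  · set K := A.biUnion id with hK
    let B : Finset ι := {i | i ∉ K ∧ a i ≠ x i}
    have hB : K.piecewise a x = fun i => a i ^^ indicatorVec B i := by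
      funext i
      by_cases hi : i ∈ K
      · simp [hi, indicatorVec, B]
      · simp only [hi, not_false_eq_true, piecewise_eq_of_notMem, indicatorVec, B, mem_filter,
          mem_univ, true_and]
        cases a i <;> cases x i <;> simp
    rw [hB]
    -- A small subset of `B` with `R` nonzero would avoid `K` and enlarge the maximal family.
    refine apply_indicatorVec_eq_zero hR B fun S hS hcS => ?_
    by_contra hRS
    have hSne : S.Nonempty := by
      rw [nonempty_iff_ne_empty]
      rintro rfl
      exact hRS hR0
    have hdisj : ∀ T ∈ A, Disjoint S T := by
      intro T hT
      rw [disjoint_left]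
      intro i hiS hiT
      have := hS hiS
      simp only [B, mem_filter] at this
      exact this.2.1 (mem_biUnion.2 ⟨T, hT, hiT⟩)
    have hSA : S ∉ A := by
      intro h
      have := hdisj S h
      rw [disjoint_self] at this
      exact hSne.ne_empty this
    have := hAmax (insert S A) ⟨?_, ?_⟩
    · rw [card_insert_of_notMem hSA] at this
      omega
    · rw [coe_insert]
      exact hA.1.insert fun T hT _ => hdisj T hT
    · intro T hT
      rcases mem_insert.1 hT with rfl | hT
      · exact ⟨hcS, hRS⟩
      · exact hA.2 T hT

/-! ### Total influence. -/

/-- Exchanging the `K`-coordinates of two points is an involution on pairs. -/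
lemma sum_sum_piecewise [Fintype ι] [DecidableEq ι] (K : Finset ι) (g : (ι → Bool) → ℕ) :
    ∑ a : ι → Bool, ∑ x : ι → Bool, g (K.piecewise a x) = 2 ^ Fintype.card ι * ∑ x, g x := by
  let e : (ι → Bool) × (ι → Bool) → (ι → Bool) × (ι → Bool) :=
    fun z => (K.piecewise z.1 z.2, K.piecewise z.2 z.1)
  have he : Function.Involutive e := by
    rintro ⟨a, x⟩
    ext i <;> by_cases hi : i ∈ K <;> simp [e, hi]
  rw [← Fintype.sum_prod_type' (f := fun a x => g (K.piecewise a x))]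
  refine (Equiv.sum_comp he.toPerm fun z => g z.1).trans ?_
  rw [Fintype.sum_prod_type]
  simp [mul_sum]

lemma sum_sensitivityCount_piecewise [Fintype ι] [DecidableEq ι] (K : Finset ι)
    (f : (ι → Bool) → Bool) {i : ι} (hi : i ∉ K) :
    ∑ a : ι → Bool, sensitivityCount (fun x => f (K.piecewise a x)) i =
      2 ^ Fintype.card ι * sensitivityCount f i := by
  have hup : ∀ a x : ι → Bool, K.piecewise a (Function.update x i (!x i)) =
      Function.update (K.piecewise a x) i (!(K.piecewise a x) i) := by
    intro a x
    funext j
    by_cases hj : j = i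
    · subst hj; simp [hi]
    · by_cases hjK : j ∈ K <;> simp [hj, hjK]
  simp only [sensitivityCount, card_filter, hup]
  exact sum_sum_piecewise K fun x => if f (Function.update x i (!x i)) ≠ f x then 1 else 0

/-- The total influence of a Boolean function with a rational representation of degree `d`. -/
theorem sum_sensitivityCount_le [Fintype ι] [DecidableEq ι] {d e : ℕ} (hed : e ≤ d)
    {f : (ι → Bool) → Bool} {p r : (ι → Bool) → ℝ} (hp : p ∈ degLE ι d) (hr : r ∈ degLE ι e)
    (hpf : ∀ x, p x ≠ 0 ↔ f x = true) (hrf : ∀ x, r x ≠ 0 ↔ f x = false) :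
    ∑ i, sensitivityCount f i ≤ 2 ^ Fintype.card ι * (e * (2 * d ^ 3)) := by
  have hconst : ∀ f : (ι → Bool) → Bool, (∀ x y, f x = f y) →
      ∑ i, sensitivityCount f i = 0 := fun f h =>
    sum_eq_zero fun i _ => by simp [sensitivityCount, h _ (fun _ => false)]
  induction e generalizing f p r with
  | zero =>
    rw [hconst f]
    · exact Nat.zero_le _
    · intro x y
      have h1 := hrf x
      have h2 := hrf y
      rw [apply_eq_of_mem_degLE_zero hr x y] at h1
      cases hx : f x <;> cases hy : f y <;> simp_all
  | succ e ih =>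
    have hpr : ∀ x, p x = 0 ↔ r x ≠ 0 := by
      intro x
      rw [hrf, ← not_iff_not, ← ne_eq, hpf]
      simp
    by_cases hne : p = 0
    · rw [hconst f]
      · exact Nat.zero_le _
      · have : ∀ x, f x = false := fun x => by
          rw [← hrf, ← hpr, hne]; rfl
        intro x y
        rw [this, this]
    obtain ⟨a, K, hK, haK⟩ := exists_certificate hp (degLE_mono hed hr) hpr hne
    have hrest : ∀ b : ι → Bool, ∑ i, sensitivityCount (fun x => f (K.piecewise b x)) i ≤
        2 ^ Fintype.card ι * (e * (2 * d ^ 3)) := by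
      intro b
      refine ih (by omega) (comp_piecewise_mem_degLE K b hp) (r := fun x => r (K.piecewise b x))
        ?_ (fun x => hpf _) (fun x => hrf _)
      -- Since `r` vanishes when `K` is set to `a`, the restriction to `b` equals the difference of
      -- the two restrictions.
      simpa [haK] using piecewise_sub_piecewise_mem_degLE K b a hr
    have hin : ∑ i ∈ K, sensitivityCount f i ≤ 2 ^ Fintype.card ι * (2 * d ^ 3) := by
      refine (sum_le_card_nsmul K _ (2 ^ Fintype.card ι) fun i _ => ?_).trans ?_
      · exact (card_filter_le _ _).trans (by simp)
      · rw [smul_eq_mul, mul_comm]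
        exact Nat.mul_le_mul_left _ hK
    have hout : ∑ i ∈ Kᶜ, sensitivityCount f i ≤ 2 ^ Fintype.card ι * (e * (2 * d ^ 3)) := by
      refine Nat.le_of_mul_le_mul_left ?_ (show 0 < 2 ^ Fintype.card ι by positivity)
      -- An influence outside `K` is the average of its values over all settings of `K`.
      rw [mul_sum, sum_congr rfl fun i hi =>
        (sum_sensitivityCount_piecewise K f (mem_compl.1 hi)).symm, sum_comm]
      refine (sum_le_card_nsmul univ _ (2 ^ Fintype.card ι * (e * (2 * d ^ 3)))
        fun b _ => ?_).trans (by simp)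
      exact (sum_le_sum_of_subset (subset_univ _)).trans (hrest b)
    rw [← sum_add_sum_compl K]
    refine (add_le_add hin hout).trans (le_of_eq ?_)
    ring

/-! ### Comparing the two influence bounds. -/

theorem two_pow_card_le_sensitivityCount [Fintype ι] [DecidableEq ι] {d : ℕ}
    {f : (ι → Bool) → Bool} {p r : (ι → Bool) → ℝ} (hp : p ∈ degLE ι d) (hr : r ∈ degLE ι d)
    (hpf : ∀ x, p x ≠ 0 ↔ f x = true) (hrf : ∀ x, r x ≠ 0 ↔ f x = false) {i : ι}
    (hi : ∃ x, f (Function.update x i (!x i)) ≠ f x) :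
    2 ^ Fintype.card ι ≤ 2 ^ (d + d) * sensitivityCount f i := by
  have hiff : ∀ x, p x * r (Function.update x i (!x i)) ≠ 0 ↔
      f x = true ∧ f (Function.update x i (!x i)) = false := by
    intro x
    rw [mul_ne_zero_iff, hpf, hrf]
  have hmem := mul_mem_degLE hp (comp_flip_mem_degLE i hr)
  refine (two_pow_card_le_card_ne_zero hmem ?_).trans (Nat.mul_le_mul_left _ (card_le_card ?_))
  · obtain ⟨x, hx⟩ := hi
    refine Function.ne_iff.2 ?_
    cases hfx : f x
    -- The product is directed from true to false, so here the flipped point is the witness.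
    · refine ⟨Function.update x i (!x i), (hiff _).2 ?_⟩
      simp_all
    · exact ⟨x, (hiff x).2 (by simp_all)⟩
  · intro x hx
    simp only [mem_filter, mem_univ, true_and] at hx ⊢
    obtain ⟨h1, h2⟩ := (hiff x).1 hx
    simp [h1, h2]

theorem card_le_of_rational [Fintype ι] [DecidableEq ι] {d : ℕ}
    {f : (ι → Bool) → Bool} {p r : (ι → Bool) → ℝ} (hp : p ∈ degLE ι d) (hr : r ∈ degLE ι d)
    (hpf : ∀ x, p x ≠ 0 ↔ f x = true) (hrf : ∀ x, r x ≠ 0 ↔ f x = false)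
    (hdep : ∀ i, ∃ x, f (Function.update x i (!x i)) ≠ f x) :
    Fintype.card ι ≤ 2 ^ (d + d) * (2 * d ^ 4) := by
  refine Nat.le_of_mul_le_mul_left ?_ (show 0 < 2 ^ Fintype.card ι by positivity)
  calc 2 ^ Fintype.card ι * Fintype.card ι = ∑ _i : ι, 2 ^ Fintype.card ι := by simp [mul_comm]
    _ ≤ ∑ i, 2 ^ (d + d) * sensitivityCount f i :=
      sum_le_sum fun i _ => two_pow_card_le_sensitivityCount hp hr hpf hrf (hdep i)
    _ = 2 ^ (d + d) * ∑ i, sensitivityCount f i := (mul_sum _ _ _).symm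
    _ ≤ 2 ^ (d + d) * (2 ^ Fintype.card ι * (d * (2 * d ^ 3))) :=
      Nat.mul_le_mul_left _ (sum_sensitivityCount_le le_rfl hp hr hpf hrf)
    _ = _ := by ring

lemma eval_bitVec_mem_degLE {n d : ℕ} (p : MvPolynomial (Fin n) ℝ) (hp : p.totalDegree ≤ d) :
    (fun x => MvPolynomial.eval (bitVec x) p) ∈ degLE (Fin n) d := by
  have : (fun x => MvPolynomial.eval (bitVec x) p) =
      ∑ m ∈ p.support, p.coeff m • monomialFun m.support := by
    funext x
    rw [MvPolynomial.eval_eq, Finset.sum_apply]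
    refine sum_congr rfl fun m _ => ?_
    rw [Pi.smul_apply, smul_eq_mul, monomialFun]
    congr 1
    refine prod_congr rfl fun i hi => ?_
    rw [bitVec]
    cases x i <;> simp [Finsupp.mem_support_iff.1 hi]
  rw [this]
  refine Submodule.sum_mem _ fun m hm => Submodule.smul_mem _ _ (monomialFun_mem_degLE ?_)
  refine le_trans ?_ ((MvPolynomial.le_totalDegree hm).trans hp)
  rw [Finsupp.sum, card_eq_sum_ones]
  exact sum_le_sum fun i hi => Nat.one_le_iff_ne_zero.2 (Finsupp.mem_support_iff.1 hi)

theorem le_of_dependsOnAllVariables {n : ℕ} {f : (Fin n → Bool) → Bool}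
    (hf : DependsOnAllVariables f) : n ≤ 2 ^ (rdeg f + rdeg f) * (2 * rdeg f ^ 4) := by
  obtain ⟨p, q, ⟨-, -, h⟩, hd⟩ := Nat.sInf_mem (rationalRepDegrees_nonempty f)
  change max _ _ = rdeg f at hd
  have hp := eval_bitVec_mem_degLE p ((le_max_left _ _).trans hd.le)
  have hq := eval_bitVec_mem_degLE q ((le_max_right _ _).trans hd.le)
  have hval : ∀ x, MvPolynomial.eval (bitVec x) p =
      (if f x then 1 else 0) * MvPolynomial.eval (bitVec x) q :=
    fun x => (div_eq_iff (h x).1).1 (h x).2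
  have := card_le_of_rational (f := f) hp (Submodule.sub_mem _ hq hp)
    (fun x => by
      have := (h x).1
      simp only [hval x]
      cases f x <;> simp [this])
    (fun x => by
      have := (h x).1
      simp only [Pi.sub_apply, hval x]
      cases f x <;> simp [this]) hf
  simpa using this

end BooleanCube

theorem mainTheorem7 :
    ∃ c : ℝ, 0 < c ∧ ∀ n : ℕ, 0 < n → ∀ f : (Fin n → Bool) → Bool,
      DependsOnAllVariables f → c * Real.log (n : ℝ) ≤ (rdeg f : ℝ) := by
  -- With `log 2 ≤ 1` and `log d ≤ d - 1` the bound gives `log n ≤ 2d + 1 + 4(d - 1)`, which is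
  -- below `7d`.
  refine ⟨1 / 7, by norm_num, fun n hn f hf => ?_⟩
  have h := BooleanCube.le_of_dependsOnAllVariables hf
  set d := rdeg f
  have hd : 0 < d := by
    by_contra hd
    rw [Nat.eq_zero_of_not_pos hd] at h
    simp at h
    omega
  have hdR : (1 : ℝ) ≤ d := by exact_mod_cast hd
  have hR : (n : ℝ) ≤ 2 ^ (d + d) * (2 * (d : ℝ) ^ 4) := by exact_mod_cast h
  have hlog := Real.log_le_log (by exact_mod_cast hn) hR
  rw [Real.log_mul (by positivity) (by positivity), Real.log_mul (by positivity) (by positivity),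
    Real.log_pow, Real.log_pow] at hlog
  push_cast at hlog
  have h2 : Real.log 2 ≤ 1 := by linarith [Real.log_two_lt_d9]
  have h3 : Real.log d ≤ d - 1 := Real.log_le_sub_one_of_pos (by linarith)
  nlinarith [mul_le_mul_of_nonneg_left h2 (by linarith : (0 : ℝ) ≤ d + d)]
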